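/- Let $d\ge 1$, $1\le p<\infty$, $\alpha\in[0,\infty)$ and $1\le r\le p'$ with $r<\infty$, where $1/p+1/p'=1$ ($p'=\infty$ if $p=1$). A weight is a locally integrable, almost everywhere positive function $w$ on $\mathbb{R}^d$; write $w(Q)=\int_Q w$ and $\langle f\rangle_Q=\frac1{|Q|}\int_Q f$. Let $[w]_{A_p}=\sup_Q\langle w\rangle_Q\langle w^{-1/(p-1)}\rangle_Q^{p-1}$ for $p>1$ and $[w]_{A_1}=\sup_Q\langle w\rangle_Q\,\operatorname{ess\,sup}_Q w^{-1}$, and for a locally integrable $b:\mathbb{R}^d\to\mathbb{C}$ let $$\|b\|_{\mathrm{BMO}_w^{r,\alpha}}=\sup_{Q}\,w(Q)^{-\alpha/d}\Big(\frac1{w(Q)}\int_Q\Big(\frac{|b-\langle b\rangle_Q|}{w}\Big)^r w\,dx\Big)^{1/r}\in[0,\infty],$$ all suprema being taken over all cubes $Q\subset\mathbb{R}^d$ with sides parallel to the coordinate axes. Then for every $K\in[0,\infty)$ there is a constant $C\in(0,\infty)$, depending only on $d,p,r,\alpha$ and $K$, such that for every weight $w$ with $[w]_{A_p}\le K$ and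 every locally integrable $b:\mathbb{R}^d\to\mathbb{C}$, $$\|b\|_{\mathrm{BMO}_w^{r,\alpha}}\le C\,\|b\|_{\mathrm{BMO}_w^{1,\alpha}}\qquad\text{and}\qquad \|b\|_{\mathrm{BMO}_w^{1,\alpha}}\le C\,\|b\|_{\mathrm{BMO}_w^{r,\alpha}}.$$ In particular, this applies to every $w\in A_p$, that is, every weight with $[w]_{A_p}<\infty$. -/

import Mathlib

open MeasureTheory
open scoped ENNReal NNReal

noncomputable section

namespace WeightedBMO

/-- The axis-parallel cube in `ℝ^d` with lower corner `a` and side length `ℓ`. -/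
def cube {d : ℕ} (a : Fin d → ℝ) (ℓ : ℝ) : Set (Fin d → ℝ) :=
  Set.univ.pi fun i => Set.Ico (a i) (a i + ℓ)

/-- The collection of all (axis-parallel, nondegenerate) cubes in `ℝ^d`. -/
def cubes (d : ℕ) : Set (Set (Fin d → ℝ)) :=
  {Q | ∃ (a : Fin d → ℝ) (ℓ : ℝ), 0 < ℓ ∧ Q = cube a ℓ}

/-- A weight: a locally integrable, almost everywhere positive function on `ℝ^d`. -/
structure IsWeight {d : ℕ} (w : (Fin d → ℝ) → ℝ) : Prop where
  locallyIntegrable : LocallyIntegrable w volume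
  pos : ∀ᵐ x, 0 < w x

/-- The measure `dw = w dx`, so that `weightMeasure w Q` is `w(Q) = ∫_Q w`. -/
def weightMeasure {d : ℕ} (w : (Fin d → ℝ) → ℝ) : Measure (Fin d → ℝ) :=
  volume.withDensity fun x => ENNReal.ofReal (w x)

/-- The Muckenhoupt characteristic `[w]_{A_p}`, with values in `[0, ∞]`: for `p > 1` it is
`sup_Q ⟨w⟩_Q ⟨w^{-1/(p-1)}⟩_Q^{p-1}`, and `[w]_{A_1} = sup_Q ⟨w⟩_Q ess sup_Q w^{-1}`. -/
def apChar {d : ℕ} (p : ℝ) (w : (Fin d → ℝ) → ℝ) : ℝ≥0∞ :=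
  ⨆ Q ∈ cubes d,
    (⨍⁻ x in Q, ENNReal.ofReal (w x) ∂volume) *
      if p = 1 then essSup (fun x => (ENNReal.ofReal (w x))⁻¹) (volume.restrict Q)
      else (⨍⁻ x in Q, ENNReal.ofReal (w x) ^ (-(1 / (p - 1))) ∂volume) ^ (p - 1)

/-- The weighted fractional oscillation
`w(Q)^{-α/d} ((1/w(Q)) ∫_Q (|b - ⟨b⟩_Q| / w)^r dw)^{1/r}`. -/
def oscillation {d : ℕ} (w : (Fin d → ℝ) → ℝ) (r α : ℝ) (b : (Fin d → ℝ) → ℂ)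
    (Q : Set (Fin d → ℝ)) : ℝ≥0∞ :=
  weightMeasure w Q ^ (-(α / d)) *
    ((weightMeasure w Q)⁻¹ *
      ∫⁻ x in Q, (‖b x - ⨍ y in Q, b y ∂volume‖ₑ / ENNReal.ofReal (w x)) ^ r
        ∂(weightMeasure w)) ^ (1 / r)

/-- The quantity `‖b‖_{BMO_w^{r,α}}`, the supremum of the oscillations over all cubes, with
values in `[0, ∞]`. -/
def bmoNorm {d : ℕ} (w : (Fin d → ℝ) → ℝ) (r α : ℝ) (b : (Fin d → ℝ) → ℂ) : ℝ≥0∞ :=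
  ⨆ Q ∈ cubes d, oscillation w r α b Q

end WeightedBMO

end

namespace WeightedBMO

open Set Filter Topology

variable {d : ℕ} {w : (Fin d → ℝ) → ℝ} {b : (Fin d → ℝ) → ℂ}

/-! The bound of the `1`-norm by the `r`-norm is Jensen's inequality on each cube. The converse, for
`r > 1`, is a John–Nirenberg-type self-improvement by absorption.

On a cube `P` let `A` be the mean of `|b - ⟨b⟩_P|`, and take Calderón–Zygmund cubes of `|b - ⟨b⟩_P|`
at height `2A`. Off them the function is at most `2A`; on a selected `Q` it is at most `|b - ⟨b⟩_Q|
+ 2^d · 2A`. After division by `w`, the normalized `L^r(dw)` norm on `P` is at most that of `2^d ·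
2A / w` plus the contribution of the selected cubes.

The weight condition enters twice. Since `r - 1 ≤ 1/(p-1)`, it bounds the mean of `w^{1-r}`, which
controls the first term (`rpow_mul_lintegral_inv_rpow_le`). It also shows that the selected cubes,
filling at most half of `P` in volume, carry at most a fraction `θ < 1` of `w(P)`
(`mul_measure_le_of_volume_le`). With `M` the supremum of the normalized oscillations over subcubes,
this gives `M ≤ c + θ^{1/r} M`. Truncation at `N` makes `M` finite, so it can be absorbed; then `N →
∞`. -/

theorem measurableSet_cube (a : Fin d → ℝ) (ℓ : ℝ) : MeasurableSet (cube a ℓ) :=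
  MeasurableSet.univ_pi fun _ => measurableSet_Ico

theorem mem_cube {a x : Fin d → ℝ} {ℓ : ℝ} :
    x ∈ cube a ℓ ↔ ∀ i, a i ≤ x i ∧ x i < a i + ℓ := by
  simp [cube]

theorem volume_cube (a : Fin d → ℝ) (ℓ : ℝ) :
    volume (cube a ℓ) = ENNReal.ofReal ℓ ^ d := by
  simp [cube, volume_pi_pi]

theorem volume_cube_pos (a : Fin d → ℝ) {ℓ : ℝ} (hℓ : 0 < ℓ) : volume (cube a ℓ) ≠ 0 := by
  rw [volume_cube]
  exact pow_ne_zero _ (by simpa using hℓ)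

theorem volume_cube_ne_top (a : Fin d → ℝ) (ℓ : ℝ) : volume (cube a ℓ) ≠ ∞ := by
  rw [volume_cube]
  exact ENNReal.pow_ne_top ENNReal.ofReal_ne_top

theorem cube_subset_Icc (a : Fin d → ℝ) (ℓ : ℝ) :
    cube a ℓ ⊆ Icc a (fun i => a i + ℓ) := fun _ hx =>
  ⟨fun i => (mem_cube.1 hx i).1, fun i => (mem_cube.1 hx i).2.le⟩

theorem cube_ae_eq_closedBall (a : Fin d → ℝ) (ℓ : ℝ) (hℓ : 0 < ℓ) :
    cube a ℓ =ᵐ[volume] Metric.closedBall (fun i => a i + ℓ / 2) (ℓ / 2) := by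
  have h : Metric.closedBall (fun i => a i + ℓ / 2) (ℓ / 2) = Icc a (fun i => a i + ℓ) := by
    rw [closedBall_pi _ (by positivity), ← pi_univ_Icc]
    refine pi_congr rfl fun i _ => ?_
    rw [Real.closedBall_eq_Icc]
    congr 1 <;> ring
  rw [h]
  exact Measure.univ_pi_Ico_ae_eq_Icc

/-- The dyadic descendant, `n` generations below `cube a ℓ`, which contains `x`. -/
def dyadicCube (a : Fin d → ℝ) (ℓ : ℝ) (n : ℕ) (x : Fin d → ℝ) : Set (Fin d → ℝ) :=
  cube (fun i => a i + ⌊(x i - a i) / (ℓ / 2 ^ n)⌋ * (ℓ / 2 ^ n)) (ℓ / 2 ^ n)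

/-! ### Dyadic subcubes and Lebesgue differentiation -/

section dyadic

variable {a : Fin d → ℝ} {ℓ : ℝ} {n m : ℕ} {x y : Fin d → ℝ}

theorem mem_dyadicCube (hℓ : 0 < ℓ) :
    y ∈ dyadicCube a ℓ n x ↔
      ∀ i, ⌊(y i - a i) / (ℓ / 2 ^ n)⌋ = ⌊(x i - a i) / (ℓ / 2 ^ n)⌋ := by
  have h : 0 < ℓ / 2 ^ n := by positivity
  rw [dyadicCube, mem_cube]
  refine forall_congr' fun i => ?_
  rw [Int.floor_eq_iff, le_div_iff₀ h, div_lt_iff₀ h]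
  constructor <;> rintro ⟨h1, h2⟩ <;> constructor <;> linarith

theorem mem_dyadicCube_self (hℓ : 0 < ℓ) : x ∈ dyadicCube a ℓ n x :=
  (mem_dyadicCube hℓ).2 fun _ => rfl

theorem dyadicCube_mem_cubes (hℓ : 0 < ℓ) : dyadicCube a ℓ n x ∈ cubes d :=
  ⟨_, _, by positivity, rfl⟩

theorem dyadicCube_eq_of_mem (hℓ : 0 < ℓ) (h : y ∈ dyadicCube a ℓ n x) :
    dyadicCube a ℓ n y = dyadicCube a ℓ n x := by
  rw [mem_dyadicCube hℓ] at h
  simp only [dyadicCube, h]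

theorem dyadicCube_succ_subset (hℓ : 0 < ℓ) :
    dyadicCube a ℓ (n + 1) x ⊆ dyadicCube a ℓ n x := by
  intro y hy
  rw [mem_dyadicCube hℓ] at hy ⊢
  intro i
  -- Integer division by two passes from the index of a cube to that of its parent.
  have key : ∀ t : ℝ, ⌊t / (ℓ / 2 ^ n)⌋ = ⌊t / (ℓ / 2 ^ (n + 1))⌋ / ((2 : ℕ) : ℤ) := by
    intro t
    rw [← Int.floor_div_natCast]
    congr 1
    rw [pow_succ]
    field_simp
    norm_num
  rw [key, key, hy i]

theorem dyadicCube_anti (hℓ : 0 < ℓ) (h : n ≤ m) :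
    dyadicCube a ℓ m x ⊆ dyadicCube a ℓ n x := by
  induction m, h using Nat.le_induction with
  | base => exact subset_rfl
  | succ k _ ih => exact (dyadicCube_succ_subset hℓ).trans ih

theorem dyadicCube_zero (hℓ : 0 < ℓ) (hx : x ∈ cube a ℓ) : dyadicCube a ℓ 0 x = cube a ℓ := by
  have : ∀ i, ⌊(x i - a i) / ℓ⌋ = 0 := fun i => by
    have := mem_cube.1 hx i
    rw [Int.floor_eq_zero_iff]
    exact ⟨div_nonneg (by linarith) hℓ.le, (div_lt_one hℓ).2 (by linarith)⟩
  simp [dyadicCube, this]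

theorem dyadicCube_subset (hℓ : 0 < ℓ) (hx : x ∈ cube a ℓ) : dyadicCube a ℓ n x ⊆ cube a ℓ :=
  dyadicCube_zero hℓ hx ▸ dyadicCube_anti hℓ (Nat.zero_le n)

theorem countable_dyadicCubes (a : Fin d → ℝ) (ℓ : ℝ) :
    {Q | ∃ n x, Q = dyadicCube a ℓ n x}.Countable := by
  refine (countable_range fun q : ℕ × (Fin d → ℤ) =>
    cube (fun i => a i + q.2 i * (ℓ / 2 ^ q.1)) (ℓ / 2 ^ q.1)).mono ?_
  rintro _ ⟨n, x, rfl⟩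
  exact ⟨(n, fun i => ⌊(x i - a i) / (ℓ / 2 ^ n)⌋), rfl⟩

theorem volume_dyadicCube_succ (hℓ : 0 < ℓ) :
    volume (dyadicCube a ℓ n x) = 2 ^ d * volume (dyadicCube a ℓ (n + 1) x) := by
  rw [dyadicCube, dyadicCube, volume_cube, volume_cube, ← mul_pow]
  congr 1
  rw [← ENNReal.ofReal_ofNat 2, ← ENNReal.ofReal_mul (by norm_num), pow_succ]
  congr 1
  field_simp

/-- Up to a null set each cube is a sup-norm ball; it contains `x` without being centred there,
which the Vitali family with enlargement factor `1` allows. -/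
theorem ae_tendsto_setLAverage_dyadicCube (hℓ : 0 < ℓ) {g : (Fin d → ℝ) → ℝ≥0∞}
    (hg : AEMeasurable g) (hfin : ∫⁻ x, g x ≠ ∞) :
    ∀ᵐ x, Tendsto (fun n => ⨍⁻ y in dyadicCube a ℓ n x, g y ∂volume) atTop (𝓝 (g x)) := by
  filter_upwards [(IsUnifLocDoublingMeasure.vitaliFamily volume 1).ae_tendsto_lintegral_div
    hg hfin] with x hx
  let c : ℕ → Fin d → ℝ := fun n i =>
    (a i + ⌊(x i - a i) / (ℓ / 2 ^ n)⌋ * (ℓ / 2 ^ n)) + ℓ / 2 ^ n / 2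
  have h1 : Tendsto (fun n : ℕ => ℓ / 2 ^ n / 2) atTop (𝓝[>] 0) := by
    refine tendsto_nhdsWithin_iff.2 ⟨?_, Eventually.of_forall fun n => ?_⟩
    · have := (tendsto_pow_atTop_nhds_zero_of_lt_one (r := (1 / 2 : ℝ)) (by norm_num)
        (by norm_num)).const_mul (ℓ / 2)
      rw [mul_zero] at this
      refine this.congr fun n => ?_
      rw [one_div, inv_pow]
      ring
    · exact mem_Ioi.2 (by positivity)
  have h2 : ∀ n, x ∈ Metric.closedBall (c n) (1 * (ℓ / 2 ^ n / 2)) := by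
    intro n
    have h : 0 < ℓ / 2 ^ n := by positivity
    have hm := mem_cube.1 (mem_dyadicCube_self (a := a) (n := n) (x := x) hℓ)
    rw [Metric.mem_closedBall, one_mul, dist_pi_le_iff (by positivity)]
    intro i
    rw [Real.dist_eq, abs_le]
    have := hm i
    constructor <;> simp only [c] <;> linarith
  have := hx.comp (IsUnifLocDoublingMeasure.tendsto_closedBall_filterAt volume c _ h1
    (Eventually.of_forall h2))
  refine this.congr fun n => ?_
  have hae := cube_ae_eq_closedBall
    (fun i => a i + ⌊(x i - a i) / (ℓ / 2 ^ n)⌋ * (ℓ / 2 ^ n)) (ℓ / 2 ^ n) (by positivity)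
  rw [dyadicCube, setLAverage_congr hae, setLAverage_eq]
  rfl

end dyadic

/-! ### Calderón–Zygmund decomposition -/

/-- Stopping time: select the first dyadic cube around each point whose mean exceeds `t`. Its parent
has mean at most `t`, hence the factor `2 ^ d`; points never stopped are handled by differentiation.
-/
theorem exists_calderonZygmund_cubes (a : Fin d → ℝ) {ℓ : ℝ} (hℓ : 0 < ℓ)
    {g : (Fin d → ℝ) → ℝ≥0∞} (hg : AEMeasurable g) (hfin : ∫⁻ x in cube a ℓ, g x ≠ ∞)
    {t : ℝ≥0∞} (ht : ⨍⁻ x in cube a ℓ, g x ∂volume ≤ t) :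
    ∃ S : Set (Set (Fin d → ℝ)), S.Countable ∧ S ⊆ cubes d ∧ S.PairwiseDisjoint id ∧
      (∀ Q ∈ S, Q ⊆ cube a ℓ ∧ t < ⨍⁻ x in Q, g x ∂volume ∧ ⨍⁻ x in Q, g x ∂volume ≤ 2 ^ d * t) ∧
      ∀ᵐ x, x ∈ cube a ℓ → x ∉ ⋃₀ S → g x ≤ t := by
  let A : ℕ → (Fin d → ℝ) → ℝ≥0∞ := fun n x => ⨍⁻ y in dyadicCube a ℓ n x, g y ∂volume
  have hA : ∀ {n m x z}, z ∈ dyadicCube a ℓ n x → m ≤ n → A m z = A m x := by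
    intro n m x z hz hmn
    simp only [A, dyadicCube_eq_of_mem hℓ (dyadicCube_anti hℓ hmn hz)]
  refine ⟨{Q | ∃ n, ∃ x ∈ cube a ℓ, Q = dyadicCube a ℓ n x ∧ t < A n x ∧ ∀ m < n, A m x ≤ t},
    ?_, ?_, ?_, ?_, ?_⟩
  · refine (countable_dyadicCubes a ℓ).mono ?_
    rintro Q ⟨n, x, -, h, -⟩
    exact ⟨n, x, h⟩
  · rintro Q ⟨n, x, -, rfl, -⟩
    exact dyadicCube_mem_cubes hℓ
  · rintro _ ⟨n, x, -, rfl, hn, hn'⟩ _ ⟨m, y, -, rfl, hm, hm'⟩ hne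
    refine Set.disjoint_left.2 fun z hzx hzy => hne ?_
    simp only [id] at hzx hzy
    -- If the generations differed, the larger cube would be an ancestor of the smaller one with
    -- mean above `t`, so the smaller would not be a first stop.
    have hnm : n = m := by
      rcases lt_trichotomy n m with h | h | h
      · rw [← hA hzx le_rfl, hA hzy h.le] at hn
        exact absurd (hm' n h) hn.not_ge
      · exact h
      · rw [← hA hzy le_rfl, hA hzx h.le] at hm
        exact absurd (hn' m h) hm.not_ge
    subst hnm
    rw [← dyadicCube_eq_of_mem hℓ hzx, dyadicCube_eq_of_mem hℓ hzy]
  · rintro Q ⟨n, x, hx, rfl, hn, hn'⟩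
    refine ⟨dyadicCube_subset hℓ hx, hn, ?_⟩
    -- Generation zero is the whole cube, excluded by `ht`; a selected cube therefore has a parent
    -- inside.
    rcases n with _ | n
    · refine absurd hn (not_lt.2 ?_)
      simpa only [A, dyadicCube_zero hℓ hx] using ht
    · refine le_trans ?_ (mul_le_mul_right (hn' n n.lt_succ_self) _)
      simp only [A, setLAverage_eq]
      rw [volume_dyadicCube_succ hℓ (n := n), ← mul_div_assoc,
        ENNReal.mul_div_mul_left _ _ (by positivity) (by finiteness)]
      exact ENNReal.div_le_div_right
        (lintegral_mono_set (dyadicCube_succ_subset hℓ)) _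
  · have hmeas := measurableSet_cube a ℓ
    filter_upwards [ae_tendsto_setLAverage_dyadicCube (a := a) hℓ (hg.indicator hmeas)
      (by rwa [lintegral_indicator hmeas])] with x hx hxQ hxS
    rw [indicator_of_mem hxQ] at hx
    refine le_of_tendsto' hx fun n => ?_
    have heq : ⨍⁻ y in dyadicCube a ℓ n x, (cube a ℓ).indicator g y ∂volume = A n x := by
      refine setLAverage_congr_fun (measurableSet_cube _ _) fun y hy => ?_
      exact indicator_of_mem (dyadicCube_subset hℓ hxQ hy) _
    rw [heq]
    clear heq
    induction n using Nat.strong_induction_on with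
    | _ n ih =>
      by_contra! hlt
      exact hxS ⟨_, ⟨n, x, hxQ, rfl, hlt, ih⟩, mem_dyadicCube_self hℓ⟩

/-! ### Jensen's inequality and consequences of the `A_p` condition -/

theorem lintegral_rpow_le_rpow_lintegral {Ω : Type*} [MeasurableSpace Ω] {ν : Measure Ω}
    [IsProbabilityMeasure ν] {s t : ℝ} (ht : 0 < t) (hts : t ≤ s) {f : Ω → ℝ≥0∞}
    (hf : AEMeasurable f ν) : ∫⁻ x, f x ^ t ∂ν ≤ (∫⁻ x, f x ^ s ∂ν) ^ (t / s) := by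
  have h := eLpNorm'_le_eLpNorm'_mul_rpow_measure_univ (μ := ν) ht hts hf.aestronglyMeasurable
  simp only [measure_univ, ENNReal.one_rpow, mul_one, eLpNorm'_eq_lintegral_enorm,
    enorm_eq_self] at h
  have h' := ENNReal.rpow_le_rpow h ht.le
  rwa [← ENNReal.rpow_mul, ← ENNReal.rpow_mul, one_div_mul_cancel ht.ne', ENNReal.rpow_one,
    one_div_mul_eq_div] at h'

theorem setLAverage_rpow_le {s t : ℝ} (ht : 0 < t) (hts : t ≤ s) {f : (Fin d → ℝ) → ℝ≥0∞}
    (hf : AEMeasurable f) (a : Fin d → ℝ) {ℓ : ℝ} (hℓ : 0 < ℓ) :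
    ⨍⁻ x in cube a ℓ, f x ^ t ∂volume ≤ (⨍⁻ x in cube a ℓ, f x ^ s ∂volume) ^ (t / s) := by
  have : Fact (volume (cube a ℓ) < ∞) := ⟨(volume_cube_ne_top a ℓ).lt_top⟩
  have : NeZero (volume.restrict (cube a ℓ)) :=
    ⟨by simpa [Measure.restrict_eq_zero] using volume_cube_pos a hℓ⟩
  exact lintegral_rpow_le_rpow_lintegral ht hts (hf.restrict.smul_measure _)

theorem weightMeasure_absolutelyContinuous (w : (Fin d → ℝ) → ℝ) : weightMeasure w ≪ volume :=
  withDensity_absolutelyContinuous _ _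

theorem setLAverage_weight (w : (Fin d → ℝ) → ℝ) (a : Fin d → ℝ) (ℓ : ℝ) :
    ⨍⁻ x in cube a ℓ, ENNReal.ofReal (w x) ∂volume =
      weightMeasure w (cube a ℓ) / volume (cube a ℓ) := by
  rw [setLAverage_eq, weightMeasure, withDensity_apply _ (measurableSet_cube a ℓ)]

namespace IsWeight

theorem aemeasurable (hw : IsWeight w) : AEMeasurable (fun x => ENNReal.ofReal (w x)) :=
  hw.locallyIntegrable.aestronglyMeasurable.aemeasurable.ennreal_ofReal

theorem measure_cube_ne_top (hw : IsWeight w) (a : Fin d → ℝ) (ℓ : ℝ) :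
    weightMeasure w (cube a ℓ) ≠ ∞ := by
  rw [weightMeasure, withDensity_apply _ (measurableSet_cube a ℓ)]
  exact ((hw.locallyIntegrable.integrableOn_isCompact isCompact_Icc).mono_set
    (cube_subset_Icc a ℓ)).lintegral_lt_top.ne

theorem measure_cube_ne_zero (hw : IsWeight w) (a : Fin d → ℝ) {ℓ : ℝ} (hℓ : 0 < ℓ) :
    weightMeasure w (cube a ℓ) ≠ 0 := by
  have : volume ≪ weightMeasure w :=
    withDensity_absolutelyContinuous' hw.aemeasurable
      (hw.pos.mono fun x hx => by simpa using hx)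
  exact fun h => volume_cube_pos a hℓ (this h)

theorem lintegral_mul_inv_rpow (hw : IsWeight w) {f : (Fin d → ℝ) → ℝ≥0∞}
    (hf : AEMeasurable f) {r : ℝ} (hr : 1 ≤ r) {E : Set (Fin d → ℝ)} (hE : MeasurableSet E) :
    ∫⁻ x in E, f x * (ENNReal.ofReal (w x))⁻¹ ^ r ∂weightMeasure w =
      ∫⁻ x in E, f x * (ENNReal.ofReal (w x))⁻¹ ^ (r - 1) := by
  refine (setLIntegral_withDensity_eq_lintegral_mul₀ hw.aemeasurable
    (hf.mul (hw.aemeasurable.inv.pow_const r)) hE).trans ?_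
  refine lintegral_congr_ae ((ae_restrict_of_ae hw.pos).mono fun x hx => ?_)
  have h0 : ENNReal.ofReal (w x) ≠ 0 := by simpa using hx
  have h : (ENNReal.ofReal (w x))⁻¹ ^ r =
      (ENNReal.ofReal (w x))⁻¹ ^ (r - 1) * (ENNReal.ofReal (w x))⁻¹ := by
    nth_rw 3 [← ENNReal.rpow_one (ENNReal.ofReal (w x))⁻¹]
    rw [← ENNReal.rpow_add_of_nonneg _ _ (by linarith) zero_le_one, sub_add_cancel]
  simp only [Pi.mul_apply, Pi.inv_apply]
  rw [h, mul_comm, mul_assoc, mul_assoc, ENNReal.inv_mul_cancel h0 ENNReal.ofReal_ne_top, mul_one]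

theorem lintegral_div (hw : IsWeight w) {f : (Fin d → ℝ) → ℝ≥0∞}
    (hf : AEMeasurable f) {E : Set (Fin d → ℝ)} (hE : MeasurableSet E) :
    ∫⁻ x in E, f x / ENNReal.ofReal (w x) ∂weightMeasure w = ∫⁻ x in E, f x := by
  simpa [div_eq_mul_inv] using hw.lintegral_mul_inv_rpow hf le_rfl hE

/-- For `p > 1` the exponent condition reads `r - 1 ≤ 1/(p-1)`, and Jensen lowers the exponent; for
`p = 1` the essential supremum dominates every power mean. -/
theorem setLAverage_mul_inv_rpow_le (hw : IsWeight w) {p r : ℝ} (hp : 1 ≤ p) (hr : 1 < r)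
    (hrp : ENNReal.ofReal r ≤ ENNReal.conjExponent (ENNReal.ofReal p)) {K : ℝ≥0∞}
    (hK : apChar p w ≤ K) (a : Fin d → ℝ) {ℓ : ℝ} (hℓ : 0 < ℓ) :
    (⨍⁻ x in cube a ℓ, ENNReal.ofReal (w x) ∂volume) ^ (r - 1) *
      ⨍⁻ x in cube a ℓ, (ENNReal.ofReal (w x))⁻¹ ^ (r - 1) ∂volume ≤ K ^ (r - 1) := by
  have hr0 : 0 < r - 1 := by linarith
  have hV0 := volume_cube_pos a hℓ
  have hV := volume_cube_ne_top a ℓ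
  have hKQ := (le_iSup₂ (f := fun Q (_ : Q ∈ cubes d) =>
    (⨍⁻ x in Q, ENNReal.ofReal (w x) ∂volume) *
      if p = 1 then essSup (fun x => (ENNReal.ofReal (w x))⁻¹) (volume.restrict Q)
      else (⨍⁻ x in Q, ENNReal.ofReal (w x) ^ (-(1 / (p - 1))) ∂volume) ^ (p - 1))
    (cube a ℓ) ⟨a, ℓ, hℓ, rfl⟩).trans hK
  suffices h : ⨍⁻ x in cube a ℓ, (ENNReal.ofReal (w x))⁻¹ ^ (r - 1) ∂volume ≤
      (if p = 1 then essSup (fun x => (ENNReal.ofReal (w x))⁻¹) (volume.restrict (cube a ℓ))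
      else (⨍⁻ x in cube a ℓ, ENNReal.ofReal (w x) ^ (-(1 / (p - 1))) ∂volume) ^ (p - 1))
        ^ (r - 1) by
    refine (mul_le_mul_right h _).trans ?_
    rw [← ENNReal.mul_rpow_of_nonneg _ _ hr0.le]
    exact ENNReal.rpow_le_rpow hKQ hr0.le
  split_ifs with h1
  · set M := essSup (fun x => (ENNReal.ofReal (w x))⁻¹) (volume.restrict (cube a ℓ))
    rw [setLAverage_eq]
    refine ENNReal.div_le_of_le_mul ?_
    calc ∫⁻ x in cube a ℓ, (ENNReal.ofReal (w x))⁻¹ ^ (r - 1)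
        ≤ ∫⁻ x in cube a ℓ, M ^ (r - 1) := lintegral_mono_ae
          ((ENNReal.ae_le_essSup _).mono fun x hx => ENNReal.rpow_le_rpow hx hr0.le)
      _ = M ^ (r - 1) * volume (cube a ℓ) := by simp
  · have hp1 : 0 < p - 1 := by
      rcases hp.lt_or_eq with h | h
      · linarith
      · exact absurd h.symm h1
    have hconj : r - 1 ≤ 1 / (p - 1) := by
      have h2 : ENNReal.conjExponent (ENNReal.ofReal p) = ENNReal.ofReal (1 + 1 / (p - 1)) := by
        rw [ENNReal.conjExponent, ENNReal.ofReal_add zero_le_one (by positivity),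
          ENNReal.ofReal_one, one_div, ENNReal.ofReal_inv_of_pos hp1,
          ENNReal.ofReal_sub _ zero_le_one, ENNReal.ofReal_one]
      rw [h2, ENNReal.ofReal_le_ofReal_iff (by positivity)] at hrp
      linarith
    have := setLAverage_rpow_le hr0 hconj hw.aemeasurable.inv a hℓ
    rw [← ENNReal.rpow_mul]
    have he : (p - 1) * (r - 1) = (r - 1) / (1 / (p - 1)) := by
      rw [div_div_eq_mul_div, div_one, mul_comm]
    simp only [he, ENNReal.rpow_neg, ← ENNReal.inv_rpow]
    exact this

theorem rpow_mul_lintegral_inv_rpow_le (hw : IsWeight w) {p r : ℝ} (hp : 1 ≤ p) (hr : 1 < r)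
    (hrp : ENNReal.ofReal r ≤ ENNReal.conjExponent (ENNReal.ofReal p)) {K : ℝ≥0∞}
    (hK : apChar p w ≤ K) (a : Fin d → ℝ) {ℓ : ℝ} (hℓ : 0 < ℓ) :
    (weightMeasure w (cube a ℓ) / volume (cube a ℓ)) ^ r *
      ∫⁻ x in cube a ℓ, (ENNReal.ofReal (w x))⁻¹ ^ r ∂weightMeasure w ≤
        K ^ (r - 1) * weightMeasure w (cube a ℓ) := by
  have hV0 := volume_cube_pos a hℓ
  have hV := volume_cube_ne_top a ℓ
  have h1 := hw.lintegral_mul_inv_rpow (f := fun _ => 1) aemeasurable_const hr.le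
    (measurableSet_cube a ℓ)
  simp only [one_mul] at h1
  have h2 := hw.setLAverage_mul_inv_rpow_le hp hr hrp hK a hℓ
  rw [setLAverage_weight] at h2
  rw [h1, ← measure_mul_setLAverage _ hV]
  set u := weightMeasure w (cube a ℓ) / volume (cube a ℓ) with hu
  set v := ⨍⁻ x in cube a ℓ, (ENNReal.ofReal (w x))⁻¹ ^ (r - 1) ∂volume
  have h3 : u ^ r = u ^ (r - 1) * u := by
    nth_rw 3 [← ENNReal.rpow_one u]
    rw [← ENNReal.rpow_add_of_nonneg _ _ (by linarith) zero_le_one, sub_add_cancel]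
  have h4 : u * volume (cube a ℓ) = weightMeasure w (cube a ℓ) := ENNReal.div_mul_cancel hV0 hV
  calc u ^ r * (volume (cube a ℓ) * v) = (u ^ (r - 1) * v) * (u * volume (cube a ℓ)) := by
        rw [h3]; ring
    _ ≤ K ^ (r - 1) * weightMeasure w (cube a ℓ) := by rw [h4]; gcongr

/-- Hölder with exponents `r` and `r'` in `dw`, applied to `|E| = ∫_E w⁻¹ dw`. -/
theorem volume_rpow_le (hw : IsWeight w) {r : ℝ} (hr : 1 < r) {E : Set (Fin d → ℝ)}
    (hE : MeasurableSet E) :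
    volume E ^ r ≤ (∫⁻ x in E, (ENNReal.ofReal (w x))⁻¹ ^ r ∂weightMeasure w) *
      weightMeasure w E ^ (r - 1) := by
  have hr0 : 0 < r := by linarith
  have h := ENNReal.lintegral_mul_le_Lp_mul_Lq ((weightMeasure w).restrict E)
    (Real.HolderConjugate.conjExponent hr)
    ((hw.aemeasurable.inv.mono_ac (weightMeasure_absolutelyContinuous w)).restrict)
    (aemeasurable_const (b := (1 : ℝ≥0∞)))
  have h1 := hw.lintegral_div (f := fun _ => 1) aemeasurable_const hE
  simp only [one_div, lintegral_const, one_mul, Measure.restrict_apply_univ] at h1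
  simp only [Pi.mul_apply, Pi.inv_apply, mul_one, ENNReal.one_rpow, lintegral_const, one_mul,
    Measure.restrict_apply_univ, h1] at h
  refine (ENNReal.rpow_le_rpow h hr0.le).trans_eq ?_
  rw [ENNReal.mul_rpow_of_nonneg _ _ hr0.le, ← ENNReal.rpow_mul, ← ENNReal.rpow_mul,
    one_div_mul_cancel hr0.ne', ENNReal.rpow_one]
  congr 2
  rw [Real.conjExponent]
  have : r - 1 ≠ 0 := by linarith
  field_simp

theorem measure_cube_le_mul (hw : IsWeight w) {p r : ℝ} (hp : 1 ≤ p) (hr : 1 < r)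
    (hrp : ENNReal.ofReal r ≤ ENNReal.conjExponent (ENNReal.ofReal p)) {K : ℝ≥0∞}
    (hK : apChar p w ≤ K) (a : Fin d → ℝ) {ℓ : ℝ} (hℓ : 0 < ℓ) {E : Set (Fin d → ℝ)}
    (hE : MeasurableSet E) (hEQ : E ⊆ cube a ℓ) (hV : volume (cube a ℓ) ≤ 2 * volume E) :
    weightMeasure w (cube a ℓ) ≤ 2 ^ (r / (r - 1)) * K * weightMeasure w E := by
  have hr0 : 0 < r := by linarith
  have hr1 : 0 < r - 1 := by linarith
  have hV0 := volume_cube_pos a hℓ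
  have hVt := volume_cube_ne_top a ℓ
  have hW0 := hw.measure_cube_ne_zero a hℓ
  have hWt := hw.measure_cube_ne_top a ℓ
  have h1 := hw.rpow_mul_lintegral_inv_rpow_le hp hr hrp hK a hℓ
  have h2 : volume E ^ r ≤ _ := (hw.volume_rpow_le hr hE).trans
    (mul_le_mul_left (lintegral_mono_set hEQ) _)
  have h3 : volume (cube a ℓ) ^ r ≤ 2 ^ r * volume E ^ r := by
    rw [← ENNReal.mul_rpow_of_nonneg _ _ hr0.le]
    exact ENNReal.rpow_le_rpow hV hr0.le
  set W := weightMeasure w (cube a ℓ)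
  set V := volume (cube a ℓ)
  set S := ∫⁻ x in cube a ℓ, (ENNReal.ofReal (w x))⁻¹ ^ r ∂weightMeasure w
  set m := weightMeasure w E
  -- One factor `W` is split off so that it cancels; the `(r-1)`-th root then yields the constant
  -- `2^{r/(r-1)} K`.
  have h4 : W * W ^ (r - 1) ≤ W * (2 ^ r * K ^ (r - 1) * m ^ (r - 1)) := by
    calc W * W ^ (r - 1) = W ^ r := by
          nth_rw 1 [← ENNReal.rpow_one W]
          rw [← ENNReal.rpow_add_of_nonneg _ _ zero_le_one hr1.le]
          congr 1; ring
      _ = (W / V) ^ r * V ^ r := by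
          rw [← ENNReal.mul_rpow_of_nonneg _ _ hr0.le, ENNReal.div_mul_cancel hV0 hVt]
      _ ≤ (W / V) ^ r * (2 ^ r * (S * m ^ (r - 1))) := by gcongr; exact h3.trans (by gcongr)
      _ = ((W / V) ^ r * S) * (2 ^ r * m ^ (r - 1)) := by ring
      _ ≤ (K ^ (r - 1) * W) * (2 ^ r * m ^ (r - 1)) := by gcongr
      _ = _ := by ring
  rw [ENNReal.mul_le_mul_iff_right hW0 hWt] at h4
  rw [← ENNReal.rpow_le_rpow_iff hr1, ENNReal.mul_rpow_of_nonneg _ _ hr1.le,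
    ENNReal.mul_rpow_of_nonneg _ _ hr1.le, ← ENNReal.rpow_mul, div_mul_cancel₀ _ hr1.ne']
  exact h4

/-- The complement of `F` fills at least half the cube, so it carries at least `1/D` of the weight.
-/
theorem mul_measure_le_of_volume_le (hw : IsWeight w) {p r : ℝ} (hp : 1 ≤ p) (hr : 1 < r)
    (hrp : ENNReal.ofReal r ≤ ENNReal.conjExponent (ENNReal.ofReal p)) {K : ℝ≥0∞}
    (hK : apChar p w ≤ K) {D : ℝ≥0} (hD : 1 ≤ D) (hDK : 2 ^ (r / (r - 1)) * K ≤ D)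
    (a : Fin d → ℝ) {ℓ : ℝ} (hℓ : 0 < ℓ) {F : Set (Fin d → ℝ)}
    (hF : MeasurableSet F) (hFQ : F ⊆ cube a ℓ) (hV : 2 * volume F ≤ volume (cube a ℓ)) :
    weightMeasure w F ≤ (1 - D⁻¹ : ℝ≥0) * weightMeasure w (cube a ℓ) := by
  have hVt := volume_cube_ne_top a ℓ
  have hWt := hw.measure_cube_ne_top a ℓ
  have hmeas := measurableSet_cube a ℓ
  have hFt : volume F ≠ ∞ := ne_top_of_le_ne_top hVt (measure_mono hFQ)
  have hdV : volume (cube a ℓ) ≤ 2 * volume (cube a ℓ \ F) := by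
    have h := measure_inter_add_sdiff (μ := volume) (cube a ℓ) hF
    rw [inter_eq_self_of_subset_right hFQ] at h
    have h2 : volume F + volume F ≤ volume F + volume (cube a ℓ \ F) := by
      rw [h, ← two_mul]; exact hV
    rw [← h, two_mul]
    exact add_le_add_left ((ENNReal.add_le_add_iff_left hFt).1 h2) _
  have h1 := (hw.measure_cube_le_mul hp hr hrp hK a hℓ (hmeas.diff hF) sdiff_subset hdV).trans
    (mul_le_mul_left hDK _)
  have h2 := measure_inter_add_sdiff (μ := weightMeasure w) (cube a ℓ) hF
  rw [inter_eq_self_of_subset_right hFQ] at h2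
  have hm1 : weightMeasure w F ≠ ∞ := ne_top_of_le_ne_top hWt (measure_mono hFQ)
  have hm2 : weightMeasure w (cube a ℓ \ F) ≠ ∞ := ne_top_of_le_ne_top hWt (measure_mono sdiff_subset)
  generalize weightMeasure w F = x at *
  generalize weightMeasure w (cube a ℓ \ F) = y at *
  rw [← h2] at h1 ⊢
  lift x to ℝ≥0 using hm1
  lift y to ℝ≥0 using hm2
  norm_cast at h1 ⊢
  rw [← NNReal.coe_le_coe] at h1 hD ⊢
  push_cast [NNReal.coe_sub (inv_le_one_of_one_le₀ hD)] at h1 hD ⊢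
  have hD0 : (0 : ℝ) < D := by linarith
  have h5 : ((x : ℝ) + y) / D ≤ y := by
    rw [div_le_iff₀ hD0]; linarith
  have : (1 - (D : ℝ)⁻¹) * (x + y) = x + y - (x + y) / D := by ring
  linarith

end IsWeight

/-! ### Oscillation estimates and absorption -/

theorem integrableOn_cube (hb : LocallyIntegrable b volume) (a : Fin d → ℝ) (ℓ : ℝ) :
    IntegrableOn b (cube a ℓ) :=
  (hb.integrableOn_isCompact isCompact_Icc).mono_set (cube_subset_Icc a ℓ)

theorem enorm_setAverage_sub_le (hb : LocallyIntegrable b volume) (a : Fin d → ℝ) {ℓ : ℝ}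
    (hℓ : 0 < ℓ) (c : ℂ) :
    ‖(⨍ y in cube a ℓ, b y ∂volume) - c‖ₑ ≤ ⨍⁻ y in cube a ℓ, ‖b y - c‖ₑ ∂volume := by
  have : Fact (volume (cube a ℓ) < ∞) := ⟨(volume_cube_ne_top a ℓ).lt_top⟩
  have : NeZero (volume.restrict (cube a ℓ)) :=
    ⟨by simpa [Measure.restrict_eq_zero] using volume_cube_pos a hℓ⟩
  have h : (⨍ y in cube a ℓ, b y ∂volume) - c = ⨍ y in cube a ℓ, (b y - c) ∂volume := by
    nth_rw 1 [← average_const (volume.restrict (cube a ℓ)) c]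
    exact (integral_sub (integrableOn_cube hb a ℓ).to_average
      (integrable_const c).to_average).symm
  rw [h]
  exact enorm_integral_le_lintegral_enorm _

/-- One Calderón–Zygmund step, with Minkowski's inequality in `L^r(dw)`. Height `2A` makes the
selected cubes fill at most half the volume by Chebyshev, so that `hθ` applies to their union. -/
theorem lintegral_truncated_rpow_le (hw : IsWeight w) (hb : LocallyIntegrable b volume) {r : ℝ}
    (hr : 1 ≤ r) (a : Fin d → ℝ) {ℓ : ℝ} (hℓ : 0 < ℓ) {N m θ : ℝ≥0∞}
    (hm : ∀ Q ∈ cubes d, Q ⊆ cube a ℓ →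
      ∫⁻ x in Q, min (‖b x - ⨍ y in Q, b y ∂volume‖ₑ / ENNReal.ofReal (w x)) N ^ r
        ∂weightMeasure w ≤ m ^ r * weightMeasure w Q)
    (hθ : ∀ F ⊆ cube a ℓ, MeasurableSet F → 2 * volume F ≤ volume (cube a ℓ) →
      weightMeasure w F ≤ θ * weightMeasure w (cube a ℓ)) :
    (∫⁻ x in cube a ℓ, min (‖b x - ⨍ y in cube a ℓ, b y ∂volume‖ₑ / ENNReal.ofReal (w x)) N ^ r
        ∂weightMeasure w) ^ (1 / r) ≤
      2 ^ d * (2 * ⨍⁻ x in cube a ℓ, ‖b x - ⨍ y in cube a ℓ, b y ∂volume‖ₑ ∂volume) *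
        (∫⁻ x in cube a ℓ, (ENNReal.ofReal (w x))⁻¹ ^ r ∂weightMeasure w) ^ (1 / r) +
      m * (θ * weightMeasure w (cube a ℓ)) ^ (1 / r) := by
  have hr0 : 0 < r := by linarith
  have hmeas := measurableSet_cube a ℓ
  have hac := weightMeasure_absolutelyContinuous w
  set P := cube a ℓ with hP
  set β := ⨍ y in P, b y ∂volume with hβ
  set A := ⨍⁻ x in P, ‖b x - β‖ₑ ∂volume with hA
  have hbm : AEMeasurable (fun x => ‖b x - β‖ₑ) :=
    (hb.aestronglyMeasurable.sub aestronglyMeasurable_const).enorm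
  have hfin : ∫⁻ x in P, ‖b x - β‖ₑ ≠ ∞ :=
    ((integrableOn_cube hb a ℓ).sub
      (integrableOn_const (volume_cube_ne_top a ℓ))).hasFiniteIntegral.ne
  obtain ⟨S, hSc, hScubes, hSd, hSQ, hSae⟩ := exists_calderonZygmund_cubes a hℓ hbm hfin
    (t := 2 * A) (le_mul_of_one_le_left zero_le one_le_two)
  have hSm : ∀ Q ∈ S, MeasurableSet Q := fun Q hQ => by
    obtain ⟨a', ℓ', -, rfl⟩ := hScubes hQ
    exact measurableSet_cube _ _
  have hUm : MeasurableSet (⋃₀ S) := MeasurableSet.sUnion hSc hSm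
  have hUP : ⋃₀ S ⊆ P := sUnion_subset fun Q hQ => (hSQ Q hQ).1
  have hUV : 2 * volume (⋃₀ S) ≤ volume P := by
    have hAV : A * volume P = ∫⁻ x in P, ‖b x - β‖ₑ := by
      rw [mul_comm]
      exact measure_mul_setLAverage _ (volume_cube_ne_top a ℓ)
    have hU : (A * 2) * volume (⋃₀ S) ≤ A * volume P := by
      rw [hAV, measure_sUnion hSc hSd hSm, ← ENNReal.tsum_mul_left]
      calc ∑' Q : S, A * 2 * volume (Q : Set (Fin d → ℝ))
          ≤ ∑' Q : S, ∫⁻ x in Q, ‖b x - β‖ₑ := by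
            refine ENNReal.tsum_le_tsum fun Q => ?_
            have hQt : volume (Q : Set (Fin d → ℝ)) ≠ ∞ :=
              ne_top_of_le_ne_top (volume_cube_ne_top a ℓ) (measure_mono (hSQ Q Q.2).1)
            rw [← measure_mul_setLAverage _ hQt, mul_comm, mul_comm A]
            exact mul_le_mul_right (hSQ Q Q.2).2.1.le _
        _ = ∫⁻ x in ⋃₀ S, ‖b x - β‖ₑ := by
            rw [sUnion_eq_biUnion]
            exact (lintegral_biUnion hSc hSm hSd _).symm
        _ ≤ _ := lintegral_mono_set hUP
    -- `A` cannot be cancelled when it vanishes, but then no cube can have positive mean and none is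
    -- selected.
    rcases eq_or_ne A 0 with h0 | h0
    · have hS : S = ∅ := by
        refine eq_empty_of_forall_notMem fun Q hQ => ?_
        have h1 := (hSQ Q hQ).2.1
        have h2 : ∫⁻ x in Q, ‖b x - β‖ₑ = 0 := by
          refine le_antisymm ((lintegral_mono_set (hSQ Q hQ).1).trans_eq ?_) zero_le
          rw [← hP, ← hAV, h0, zero_mul]
        simp [setLAverage_eq, h2] at h1
      simp [hS]
    · have ht : A ≠ ∞ := (setLAverage_lt_top hfin).ne
      rwa [mul_assoc, ENNReal.mul_le_mul_iff_right h0 ht] at hU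
  set F : (Fin d → ℝ) → ℝ≥0∞ := fun x => min (‖b x - β‖ₑ / ENNReal.ofReal (w x)) N with hF
  set c : (Fin d → ℝ) → ℝ≥0∞ := fun x => 2 ^ d * (2 * A) * (ENNReal.ofReal (w x))⁻¹ with hc
  have hFm : AEMeasurable F ((weightMeasure w).restrict P) :=
    (((hbm.div hw.aemeasurable).min aemeasurable_const).mono_ac hac).restrict
  have hcm : AEMeasurable c ((weightMeasure w).restrict P) :=
    ((hw.aemeasurable.inv.const_mul _).mono_ac hac).restrict
  have hoff : ∀ᵐ x ∂(weightMeasure w).restrict P,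
      (F x - c x) ^ r ≤ (⋃₀ S).indicator (fun x => (F x - c x) ^ r) x := by
    filter_upwards [ae_restrict_of_ae (hac.ae_le hSae), ae_restrict_mem hmeas] with x hx hxP
    by_cases hxS : x ∈ ⋃₀ S
    · rw [indicator_of_mem hxS]
    · have h1 : F x ≤ c x := by
        refine (min_le_left _ _).trans ?_
        rw [div_eq_mul_inv]
        refine mul_le_mul_left ((hx hxP hxS).trans ?_) _
        exact le_mul_of_one_le_left zero_le (one_le_pow₀ one_le_two)
      rw [tsub_eq_zero_of_le h1, ENNReal.zero_rpow_of_pos hr0]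
      exact zero_le
  -- The same truncation level survives on the smaller cube because `F - c ≤ F ≤ N`; this lets `hm`
  -- be applied there.
  have hon : ∀ Q ∈ S, ∀ x, F x - c x ≤
      min (‖b x - ⨍ y in Q, b y ∂volume‖ₑ / ENNReal.ofReal (w x)) N := by
    intro Q hQ x
    obtain ⟨-, -, h2⟩ := hSQ Q hQ
    obtain ⟨a', ℓ', hℓ', rfl⟩ := hScubes hQ
    refine le_min ?_ (tsub_le_self.trans (min_le_right _ _))
    rw [tsub_le_iff_right]
    refine (min_le_left _ _).trans ?_
    simp only [hc, div_eq_mul_inv]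
    rw [← add_mul]
    gcongr
    calc ‖b x - β‖ₑ = ‖(b x - ⨍ y in cube a' ℓ', b y ∂volume) +
          ((⨍ y in cube a' ℓ', b y ∂volume) - β)‖ₑ := by rw [sub_add_sub_cancel]
      _ ≤ _ := (enorm_add_le _ _).trans
        (add_le_add_right ((enorm_setAverage_sub_le hb a' hℓ' β).trans h2) _)
  have hg : ∫⁻ x in P, (F x - c x) ^ r ∂weightMeasure w ≤
      m ^ r * (θ * weightMeasure w P) := by
    calc ∫⁻ x in P, (F x - c x) ^ r ∂weightMeasure w
        ≤ ∫⁻ x in P, (⋃₀ S).indicator (fun x => (F x - c x) ^ r) x ∂weightMeasure w :=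
          lintegral_mono_ae hoff
      _ ≤ ∫⁻ x, (⋃₀ S).indicator (fun x => (F x - c x) ^ r) x ∂weightMeasure w :=
          setLIntegral_le_lintegral _ _
      _ = ∑' Q : S, ∫⁻ x in Q, (F x - c x) ^ r ∂weightMeasure w := by
          rw [lintegral_indicator hUm, sUnion_eq_biUnion]
          exact lintegral_biUnion hSc hSm hSd _
      _ ≤ ∑' Q : S, m ^ r * weightMeasure w Q := by
          refine ENNReal.tsum_le_tsum fun Q => ?_
          refine le_trans (lintegral_mono fun x => ?_) (hm Q (hScubes Q.2) (hSQ Q Q.2).1)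
          exact ENNReal.rpow_le_rpow (hon Q Q.2 x) hr0.le
      _ = m ^ r * weightMeasure w (⋃₀ S) := by
          rw [ENNReal.tsum_mul_left, measure_sUnion hSc hSd hSm]
      _ ≤ _ := mul_le_mul_right (hθ _ hUP hUm hUV) _
  calc (∫⁻ x in P, F x ^ r ∂weightMeasure w) ^ (1 / r)
      ≤ (∫⁻ x in P, (c + (F - c)) x ^ r ∂weightMeasure w) ^ (1 / r) := by
        gcongr with x
        exact le_add_tsub
    _ ≤ (∫⁻ x in P, c x ^ r ∂weightMeasure w) ^ (1 / r) +
        (∫⁻ x in P, (F - c) x ^ r ∂weightMeasure w) ^ (1 / r) :=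
        ENNReal.lintegral_Lp_add_le hcm (hFm.sub hcm) hr
    _ ≤ _ := by
        refine add_le_add (le_of_eq ?_) ?_
        · have hint : ∫⁻ x in P, c x ^ r ∂weightMeasure w = (2 ^ d * (2 * A)) ^ r *
              ∫⁻ x in P, (ENNReal.ofReal (w x))⁻¹ ^ r ∂weightMeasure w := by
            refine (lintegral_congr fun x => ENNReal.mul_rpow_of_nonneg _ _ hr0.le).trans ?_
            exact lintegral_const_mul'' _ ((hw.aemeasurable.inv.pow_const r).mono_ac hac).restrict
          rw [hint, ENNReal.mul_rpow_of_nonneg _ _ (by positivity), ← ENNReal.rpow_mul,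
            mul_one_div_cancel hr0.ne', ENNReal.rpow_one]
        · refine (ENNReal.rpow_le_rpow hg (by positivity)).trans_eq ?_
          rw [ENNReal.mul_rpow_of_nonneg _ _ (by positivity), ← ENNReal.rpow_mul,
            mul_one_div_cancel hr0.ne', ENNReal.rpow_one]

theorem setLAverage_le_of_oscillation_le (hw : IsWeight w) (hb : LocallyIntegrable b volume)
    {α : ℝ} (a : Fin d → ℝ) {ℓ : ℝ} (hℓ : 0 < ℓ) {B : ℝ≥0∞}
    (hB : oscillation w 1 α b (cube a ℓ) ≤ B) :
    ⨍⁻ x in cube a ℓ, ‖b x - ⨍ y in cube a ℓ, b y ∂volume‖ₑ ∂volume ≤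
      B * weightMeasure w (cube a ℓ) ^ (α / d) *
        (weightMeasure w (cube a ℓ) / volume (cube a ℓ)) := by
  have hbm : AEMeasurable (fun x => ‖b x - ⨍ y in cube a ℓ, b y ∂volume‖ₑ) :=
    (hb.aestronglyMeasurable.sub aestronglyMeasurable_const).enorm
  have hW0 := hw.measure_cube_ne_zero a hℓ
  have hWt := hw.measure_cube_ne_top a ℓ
  simp only [oscillation, ENNReal.rpow_one, div_one] at hB
  rw [hw.lintegral_div hbm (measurableSet_cube a ℓ)] at hB
  rw [setLAverage_eq, ← mul_div_assoc]
  refine ENNReal.div_le_div_right ?_ _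
  set W := weightMeasure w (cube a ℓ)
  set I := ∫⁻ x in cube a ℓ, ‖b x - ⨍ y in cube a ℓ, b y ∂volume‖ₑ
  calc I = (W ^ (-(α / d)) * W ^ (α / d)) * (W⁻¹ * W) * I := by
        rw [← ENNReal.rpow_add _ _ hW0 hWt, neg_add_cancel, ENNReal.rpow_zero,
          ENNReal.inv_mul_cancel hW0 hWt, one_mul, one_mul]
    _ = (W ^ (-(α / d)) * (W⁻¹ * I)) * W ^ (α / d) * W := by ring
    _ ≤ _ := by gcongr

/-- Absorption: `(1 - D⁻¹)^ε < 1`, and finiteness of `M` permits moving its multiple to the left. -/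
theorem le_of_le_add_mul {M c : ℝ≥0∞} {D : ℝ≥0} (hD : 1 ≤ D) {ε : ℝ} (hε : 0 < ε)
    (hM : M ≠ ∞) (h : M ≤ c + M * ((1 - D⁻¹ : ℝ≥0) : ℝ≥0∞) ^ ε) :
    M ≤ ((1 - (1 - D⁻¹) ^ ε)⁻¹ : ℝ≥0) * c := by
  have hlt : (1 - D⁻¹ : ℝ≥0) ^ ε < 1 := by
    refine NNReal.rpow_lt_one ?_ hε
    exact tsub_lt_self zero_lt_one (by positivity)
  rw [← ENNReal.coe_rpow_of_nonneg _ hε.le] at h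
  generalize (1 - D⁻¹ : ℝ≥0) ^ ε = η at *
  have hη : 0 < 1 - η := tsub_pos_of_lt hlt
  rcases eq_or_ne c ∞ with rfl | hc
  · rw [ENNReal.mul_top (by simpa using hη.ne')]; exact le_top
  lift M to ℝ≥0 using hM
  lift c to ℝ≥0 using hc
  norm_cast at h ⊢
  rw [inv_mul_eq_div, le_div_iff₀ hη, ← NNReal.coe_le_coe]
  rw [← NNReal.coe_le_coe] at h
  push_cast [NNReal.coe_sub hlt.le] at h ⊢
  linarith

theorem oscillation_one_le (hw : IsWeight w) (hb : LocallyIntegrable b volume) {r : ℝ}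
    (hr : 1 ≤ r) (α : ℝ) (a : Fin d → ℝ) {ℓ : ℝ} (hℓ : 0 < ℓ) :
    oscillation w 1 α b (cube a ℓ) ≤ oscillation w r α b (cube a ℓ) := by
  have hW0 := hw.measure_cube_ne_zero a hℓ
  have hWt := hw.measure_cube_ne_top a ℓ
  have hbm : AEMeasurable (fun x => ‖b x - ⨍ y in cube a ℓ, b y ∂volume‖ₑ) :=
    (hb.aestronglyMeasurable.sub aestronglyMeasurable_const).enorm
  have hprob : IsProbabilityMeasure
      ((weightMeasure w (cube a ℓ))⁻¹ • (weightMeasure w).restrict (cube a ℓ)) :=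
    ⟨by simp [ENNReal.inv_mul_cancel hW0 hWt]⟩
  have h := lintegral_rpow_le_rpow_lintegral one_pos hr
    ((((hbm.div hw.aemeasurable).mono_ac (weightMeasure_absolutelyContinuous w)).restrict
      (s := cube a ℓ)).smul_measure (weightMeasure w (cube a ℓ))⁻¹)
  rw [lintegral_smul_measure, lintegral_smul_measure] at h
  rw [oscillation, oscillation]
  refine mul_le_mul_right ?_ _
  rw [div_one, ENNReal.rpow_one]
  exact h

theorem lintegral_truncated_rpow_le_of_apChar_le (hw : IsWeight w)
    (hb : LocallyIntegrable b volume) {p r α : ℝ} (hp : 1 ≤ p) (hr : 1 < r) (hα : 0 ≤ α)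
    (hrp : ENNReal.ofReal r ≤ ENNReal.conjExponent (ENNReal.ofReal p)) {K : ℝ≥0∞}
    (hK : apChar p w ≤ K) {D : ℝ≥0} (hD : 1 ≤ D) (hDK : 2 ^ (r / (r - 1)) * K ≤ D)
    (a : Fin d → ℝ) {ℓ : ℝ} (hℓ : 0 < ℓ) (N : ℕ) :
    ∫⁻ x in cube a ℓ, min (‖b x - ⨍ y in cube a ℓ, b y ∂volume‖ₑ / ENNReal.ofReal (w x)) N ^ r
        ∂weightMeasure w ≤
      (((1 - (1 - D⁻¹) ^ (1 / r))⁻¹ : ℝ≥0) * (2 ^ d * 2 * (bmoNorm w 1 α b *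
        weightMeasure w (cube a ℓ) ^ (α / d)) * (K ^ (r - 1)) ^ (1 / r))) ^ r *
      weightMeasure w (cube a ℓ) := by
  have hr0 : 0 < r := by linarith
  have hir : 0 < 1 / r := by positivity
  set X : Set (Fin d → ℝ) → ℝ≥0∞ := fun Q =>
    ∫⁻ x in Q, min (‖b x - ⨍ y in Q, b y ∂volume‖ₑ / ENNReal.ofReal (w x)) N ^ r
      ∂weightMeasure w with hX
  -- Only subcubes of the fixed cube compete: as `α ≥ 0`, their factors `w(Q)^{α/d}` are bounded by
  -- that of the fixed cube.
  set M : ℝ≥0∞ := ⨆ Q ∈ {Q | Q ∈ cubes d ∧ Q ⊆ cube a ℓ}, (X Q / weightMeasure w Q) ^ (1 / r)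
    with hM
  have hle : ∀ Q ∈ cubes d, Q ⊆ cube a ℓ → X Q ≤ M ^ r * weightMeasure w Q := by
    rintro _ ⟨a', ℓ', hℓ', rfl⟩ hQ
    have h : (X (cube a' ℓ') / weightMeasure w (cube a' ℓ')) ^ (1 / r) ≤ M :=
      le_iSup₂ (f := fun Q (_ : Q ∈ {Q | Q ∈ cubes d ∧ Q ⊆ cube a ℓ}) =>
        (X Q / weightMeasure w Q) ^ (1 / r)) (cube a' ℓ') ⟨⟨a', ℓ', hℓ', rfl⟩, hQ⟩
    rw [one_div, ENNReal.rpow_inv_le_iff hr0] at h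
    exact (ENNReal.div_le_iff (hw.measure_cube_ne_zero a' hℓ') (hw.measure_cube_ne_top a' ℓ')).1 h
  -- Truncation gives `M ≤ N`. Only finiteness matters: the final bound does not depend on `N`.
  have hMt : M ≠ ∞ := by
    refine ne_top_of_le_ne_top (ENNReal.natCast_ne_top N) (iSup₂_le ?_)
    rintro _ ⟨⟨a', ℓ', hℓ', rfl⟩, -⟩
    rw [one_div, ENNReal.rpow_inv_le_iff hr0]
    refine ENNReal.div_le_of_le_mul ?_
    calc X (cube a' ℓ') ≤ ∫⁻ _ in cube a' ℓ', (N : ℝ≥0∞) ^ r ∂weightMeasure w :=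
          lintegral_mono fun x => ENNReal.rpow_le_rpow (min_le_right _ _) hr0.le
      _ = _ := by simp
  refine (hle _ ⟨a, ℓ, hℓ, rfl⟩ subset_rfl).trans
    (mul_le_mul_left (ENNReal.rpow_le_rpow (le_of_le_add_mul hD hir hMt (iSup₂_le ?_)) hr0.le) _)
  rintro _ ⟨⟨a', ℓ', hℓ', rfl⟩, hQ⟩
  have h1 := lintegral_truncated_rpow_le hw hb hr.le a' hℓ' (N := N) (m := M)
    (θ := (1 - D⁻¹ : ℝ≥0)) (fun Q h h' => hle Q h (h'.trans hQ))
    (fun F h h' h'' => hw.mul_measure_le_of_volume_le hp hr hrp hK hD hDK a' hℓ' h' h h'')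
  have h2 := setLAverage_le_of_oscillation_le hw hb a' hℓ' (le_iSup₂
    (f := fun Q (_ : Q ∈ cubes d) => oscillation w 1 α b Q) (cube a' ℓ') ⟨a', ℓ', hℓ', rfl⟩)
  have h3 := hw.rpow_mul_lintegral_inv_rpow_le hp hr hrp hK a' hℓ'
  have h4 : weightMeasure w (cube a' ℓ') ^ (α / d) ≤ weightMeasure w (cube a ℓ) ^ (α / d) :=
    ENNReal.rpow_le_rpow (measure_mono hQ) (by positivity)
  have hW0 := hw.measure_cube_ne_zero a' hℓ'
  have hWt := hw.measure_cube_ne_top a' ℓ'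
  rw [ENNReal.div_rpow_of_nonneg _ _ hir.le]
  refine ENNReal.div_le_of_le_mul (h1.trans ?_)
  change ⨍⁻ x in cube a' ℓ', ‖b x - ⨍ y in cube a' ℓ', b y ∂volume‖ₑ ∂volume ≤
    bmoNorm w 1 α b * _ * _ at h2
  set A := ⨍⁻ x in cube a' ℓ', ‖b x - ⨍ y in cube a' ℓ', b y ∂volume‖ₑ ∂volume
  set S := ∫⁻ x in cube a' ℓ', (ENNReal.ofReal (w x))⁻¹ ^ r ∂weightMeasure w
  set W := weightMeasure w (cube a' ℓ')
  set V := volume (cube a' ℓ')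
  set B := bmoNorm w 1 α b
  have h5 : A * S ^ (1 / r) ≤ B * weightMeasure w (cube a ℓ) ^ (α / d) *
      ((K ^ (r - 1)) ^ (1 / r) * W ^ (1 / r)) := by
    calc A * S ^ (1 / r) ≤ (B * weightMeasure w (cube a ℓ) ^ (α / d) * (W / V)) * S ^ (1 / r) := by
          gcongr; exact h2.trans (by gcongr)
      _ = B * weightMeasure w (cube a ℓ) ^ (α / d) * ((W / V) ^ r * S) ^ (1 / r) := by
          rw [ENNReal.mul_rpow_of_nonneg _ _ hir.le, ← ENNReal.rpow_mul,
            mul_one_div_cancel hr0.ne', ENNReal.rpow_one, mul_assoc]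
      _ ≤ _ := by
          rw [← ENNReal.mul_rpow_of_nonneg _ _ hir.le]
          gcongr
  rw [ENNReal.mul_rpow_of_nonneg _ _ hir.le]
  calc _ = 2 ^ d * 2 * (A * S ^ (1 / r)) +
        M * ((1 - D⁻¹ : ℝ≥0) : ℝ≥0∞) ^ (1 / r) * W ^ (1 / r) := by ring
    _ ≤ 2 ^ d * 2 * (B * weightMeasure w (cube a ℓ) ^ (α / d) *
        ((K ^ (r - 1)) ^ (1 / r) * W ^ (1 / r))) +
        M * ((1 - D⁻¹ : ℝ≥0) : ℝ≥0∞) ^ (1 / r) * W ^ (1 / r) := by gcongr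
    _ = _ := by ring

theorem oscillation_le_mul_bmoNorm_one (hw : IsWeight w)
    (hb : LocallyIntegrable b volume) {p r α : ℝ} (hp : 1 ≤ p) (hr : 1 < r) (hα : 0 ≤ α)
    (hrp : ENNReal.ofReal r ≤ ENNReal.conjExponent (ENNReal.ofReal p)) {K : ℝ≥0∞}
    (hK : apChar p w ≤ K) {D : ℝ≥0} (hD : 1 ≤ D) (hDK : 2 ^ (r / (r - 1)) * K ≤ D)
    (a : Fin d → ℝ) {ℓ : ℝ} (hℓ : 0 < ℓ) :
    oscillation w r α b (cube a ℓ) ≤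
      ((1 - (1 - D⁻¹) ^ (1 / r))⁻¹ : ℝ≥0) * (2 ^ d * 2) * (K ^ (r - 1)) ^ (1 / r) *
        bmoNorm w 1 α b := by
  have hr0 : 0 < r := by linarith
  have hW0 := hw.measure_cube_ne_zero a hℓ
  have hWt := hw.measure_cube_ne_top a ℓ
  have hbm : AEMeasurable (fun x => ‖b x - ⨍ y in cube a ℓ, b y ∂volume‖ₑ) :=
    (hb.aestronglyMeasurable.sub aestronglyMeasurable_const).enorm
  have hhm := ((hbm.div hw.aemeasurable).mono_ac (weightMeasure_absolutelyContinuous w)).restrict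
    (s := cube a ℓ)
  -- Monotone convergence removes the truncation.
  have h := lintegral_tendsto_of_tendsto_of_monotone
    (f := fun N x => min (‖b x - ⨍ y in cube a ℓ, b y ∂volume‖ₑ / ENNReal.ofReal (w x))
      ((N : ℕ) : ℝ≥0∞) ^ r)
    (F := fun x => (‖b x - ⨍ y in cube a ℓ, b y ∂volume‖ₑ / ENNReal.ofReal (w x)) ^ r)
    (fun N => (hhm.min aemeasurable_const).pow_const r)
    (Eventually.of_forall fun x N N' hN => by
      dsimp only
      gcongr)
    (Eventually.of_forall fun x => by
      have h1 := (tendsto_const_nhds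
        (x := ‖b x - ⨍ y in cube a ℓ, b y ∂volume‖ₑ / ENNReal.ofReal (w x))).min
        ENNReal.tendsto_nat_nhds_top
      rw [min_top_right] at h1
      exact (ENNReal.continuous_rpow_const.tendsto _).comp h1)
  have h2 := le_of_tendsto' h fun N =>
    lintegral_truncated_rpow_le_of_apChar_le hw hb hp hr hα hrp hK hD hDK a hℓ N
  rw [oscillation]
  set W := weightMeasure w (cube a ℓ)
  set B := bmoNorm w 1 α b
  set c : ℝ≥0∞ := (((1 - (1 - D⁻¹) ^ (1 / r))⁻¹ : ℝ≥0) : ℝ≥0∞)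
  set I := ∫⁻ x in cube a ℓ,
    (‖b x - ⨍ y in cube a ℓ, b y ∂volume‖ₑ / ENNReal.ofReal (w x)) ^ r ∂weightMeasure w
  have h3 : (W⁻¹ * I) ^ (1 / r) ≤
      c * (2 ^ d * 2 * (B * W ^ (α / d)) * (K ^ (r - 1)) ^ (1 / r)) := by
    rw [one_div, ENNReal.rpow_inv_le_iff hr0, mul_comm, ← div_eq_mul_inv, ← one_div]
    exact ENNReal.div_le_of_le_mul h2
  calc W ^ (-(α / d)) * (W⁻¹ * I) ^ (1 / r)
      ≤ W ^ (-(α / d)) * (c * (2 ^ d * 2 * (B * W ^ (α / d)) * (K ^ (r - 1)) ^ (1 / r))) := by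
        gcongr
    _ = (W ^ (-(α / d)) * W ^ (α / d)) * (c * (2 ^ d * 2) * (K ^ (r - 1)) ^ (1 / r) * B) := by
        ring
    _ = _ := by
        rw [← ENNReal.rpow_add _ _ hW0 hWt, neg_add_cancel, ENNReal.rpow_zero, one_mul]

end WeightedBMO

/-! ### Choice of the constants -/

theorem theoremA1 (d : ℕ) (hd : 1 ≤ d) (p : ℝ) (hp : 1 ≤ p) (α : ℝ) (hα : 0 ≤ α)
    (r : ℝ) (hr : 1 ≤ r) (hrp : ENNReal.ofReal r ≤ ENNReal.conjExponent (ENNReal.ofReal p))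
    (K : ℝ≥0) :
    ∃ C : ℝ≥0, 0 < C ∧
      ∀ w : (Fin d → ℝ) → ℝ, WeightedBMO.IsWeight w → WeightedBMO.apChar p w ≤ (K : ℝ≥0∞) →
        ∀ b : (Fin d → ℝ) → ℂ, LocallyIntegrable b volume →
          WeightedBMO.bmoNorm w r α b ≤ C * WeightedBMO.bmoNorm w 1 α b ∧
          WeightedBMO.bmoNorm w 1 α b ≤ C * WeightedBMO.bmoNorm w r α b := by
  -- At `r = 1` the two norms coincide, while the exponent `r/(r-1)` degenerates.
  rcases hr.eq_or_lt with rfl | hr1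
  · exact ⟨1, one_pos, fun w _ _ b _ => by simp⟩
  -- The `1` in the maximum makes the truncated subtraction `1 - D⁻¹` a genuine one.
  set D : ℝ≥0 := max 1 (2 ^ (r / (r - 1)) * K)
  have hDK : (2 : ℝ≥0∞) ^ (r / (r - 1)) * K ≤ D := by
    have h : 2 ^ (r / (r - 1)) * K ≤ D := le_max_right _ _
    have h0 : 0 ≤ r / (r - 1) := div_nonneg (by linarith) (by linarith)
    rw [← ENNReal.coe_ofNat, ← ENNReal.coe_rpow_of_nonneg _ h0]
    exact_mod_cast h
  set C : ℝ≥0 := (1 - (1 - D⁻¹) ^ (1 / r))⁻¹ * (2 ^ d * 2) * (K ^ (r - 1)) ^ (1 / r)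
  have hC : (C : ℝ≥0∞) = ((1 - (1 - D⁻¹) ^ (1 / r))⁻¹ : ℝ≥0) * (2 ^ d * 2) *
      ((K : ℝ≥0∞) ^ (r - 1)) ^ (1 / r) := by
    rw [← ENNReal.coe_rpow_of_nonneg _ (by linarith),
      ← ENNReal.coe_rpow_of_nonneg _ (by positivity)]
    simp only [C]
    push_cast
    rfl
  -- The maximum serves the Jensen direction, whose constant is `1`, and keeps the constant positive
  -- when `K = 0`.
  refine ⟨max 1 C, lt_max_of_lt_left one_pos, fun w hw hK b hb => ⟨?_, ?_⟩⟩
  · refine iSup₂_le ?_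
    rintro _ ⟨a, ℓ, hℓ, rfl⟩
    refine (WeightedBMO.oscillation_le_mul_bmoNorm_one hw hb hp hr1 hα hrp hK
      (le_max_left _ _) hDK a hℓ).trans ?_
    rw [← hC]
    gcongr
    exact le_max_right _ _
  · calc WeightedBMO.bmoNorm w 1 α b ≤ WeightedBMO.bmoNorm w r α b := by
          refine iSup₂_mono ?_
          rintro _ ⟨a, ℓ, hℓ, rfl⟩
          exact WeightedBMO.oscillation_one_le hw hb hr α a hℓ
      _ ≤ _ := le_mul_of_one_le_left zero_le (by exact_mod_cast le_max_left 1 C)
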